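/- Let $\mathbb{T}^2=\mathbb{R}^2/\mathbb{Z}^2$, identify $T^*\mathbb{T}^2$ with $\mathbb{T}^2\times\mathbb{R}^2$, and let $V\in C^\infty(\mathbb{T}^2;\mathbb{R})$. Let $\Lambda\subset\mathbb{Z}^2$ be a primitive sublattice of rank $1$, i.e. its real linear span $\langle\Lambda\rangle$ is one-dimensional and $\langle\Lambda\rangle\cap\mathbb{Z}^2=\Lambda$. Let $\mathfrak{e}_\Lambda=(e_1,e_2)$ be a generator of $\Lambda$, and put $\mathfrak{e}_\Lambda^\perp=(-e_2,e_1)$ and $L_\Lambda=\|\mathfrak{e}_\Lambda\|$. Define on $T^*\mathbb{T}^2$ $$H_\Lambda(x,\xi)=\frac{1}{L_\Lambda}\langle\xi,\mathfrak{e}_\Lambda\rangle,\qquad H_\Lambda^\perp(x,\xi)=\frac{1}{L_\Lambda}\langle\xi,\mathfrak{e}_\Lambda^\perp\rangle,\qquad p_\Lambda(x,\xi)=\frac{H_\Lambda(x,\xi)^2}{2}+\mathcal{I}_\Lambda(V)(x),$$ where $$\mathcal{I}_\Lambda(V)(x)=\frac{1}{L_\Lambda}\int_0^{L_\Lambda}V\Big(x+s\,\frac{\mathfrak{e}_\Lambda^\perp}{L_\Lambda}\Big)\,ds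 .$$ For $p=H_\Lambda^\perp$ and $p=p_\Lambda$, let $\varphi_p^t$ ($t\in\mathbb{R}$) denote the Hamiltonian flow of $p$ on $T^*\mathbb{T}^2$, that is, the (complete) flow of $\dot x=\partial_\xi p$, $\dot\xi=-\partial_x p$. Let $$\mathcal{R}(\Lambda)=T^*\mathbb{T}^2\setminus\{(x,\xi):\ H_\Lambda(x,\xi)=0\ \text{ and }\ \partial_x\mathcal{I}_\Lambda(V)(x)=0\},$$ and let $\Pi:T^*\mathbb{T}^2\to\mathbb{T}^2$ be the canonical projection. **Theorem.** Let $\mu$ be a probability measure on $\mathcal{R}(\Lambda)$ that is invariant under $\varphi_{H_\Lambda^\perp}^t$ and $\varphi_{p_\Lambda}^t$ for all $t\in\mathbb{R}$. Then $\Pi_*\mu$ is a probability measure on $\mathbb{T}^2$ that is absolutely continuous with respect to the Lebesgue measure. -/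

import Mathlib

open MeasureTheory
open scoped ContDiff

namespace BiInv

noncomputable section

/-- The torus `ℝ² / ℤ²`. Its measure `volume` is the normalised Lebesgue measure. -/
abbrev T2 : Type := UnitAddTorus (Fin 2)

/-- The Euclidean plane. -/
abbrev E2 : Type := EuclideanSpace ℝ (Fin 2)

/-- The cotangent bundle of the torus, in its standard trivialisation. -/
abbrev CotT2 : Type := T2 × E2

/-- The quotient map from the plane to the torus. -/
def proj (v : E2) : T2 := fun i => ((v i : ℝ) : UnitAddCircle)

/-- Smooth real functions on the torus: those whose periodic lift to the plane is smooth. -/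
def SmoothOnTorus (V : T2 → ℝ) : Prop := ContDiff ℝ ∞ (fun v : E2 => V (proj v))

/-- An integer vector as a vector of the plane. -/
def intVec (k : Fin 2 → ℤ) : E2 := WithLp.toLp 2 (fun i => (k i : ℝ))

/-- The real linear span of a lattice. -/
def realSpan (L : AddSubgroup (Fin 2 → ℤ)) : Submodule ℝ E2 :=
  Submodule.span ℝ (intVec '' (L : Set (Fin 2 → ℤ)))

/-- Primitive sublattices of `ℤ²` of rank one. -/
structure IsPrimitiveRankOne (L : AddSubgroup (Fin 2 → ℤ)) : Prop where
  rank_one : Module.finrank ℝ (realSpan L) = 1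
  primitive : ∀ k : Fin 2 → ℤ, intVec k ∈ realSpan L → k ∈ L

/-- The length of a generator of the lattice. -/
def len (e : Fin 2 → ℤ) : ℝ := ‖intVec e‖

/-- The integer vector obtained from `e` by a rotation of angle `π / 2`. -/
def perp (e : Fin 2 → ℤ) : Fin 2 → ℤ := ![-(e 1), e 0]

/-- The Hamiltonian `H`, the component of the momentum along `e`. -/
def Ham (e : Fin 2 → ℤ) (z : CotT2) : ℝ := (1 / len e) * inner ℝ z.2 (intVec e)

/-- The Hamiltonian `H^⊥`, the component of the momentum orthogonal to `e`. -/
def HamPerp (e : Fin 2 → ℤ) (z : CotT2) : ℝ := (1 / len e) * inner ℝ z.2 (intVec (perp e))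

/-- The average of `V` along the closed geodesics directed by `e^⊥`. -/
def average (e : Fin 2 → ℤ) (V : T2 → ℝ) (x : T2) : ℝ :=
  (1 / len e) * ∫ s in (0 : ℝ)..(len e), V (x + proj ((s / len e) • intVec (perp e)))

/-- The Hamiltonian `p = H² / 2 + I(V)` on the cotangent bundle. -/
def pHam (e : Fin 2 → ℤ) (V : T2 → ℝ) (z : CotT2) : ℝ :=
  Ham e z ^ 2 / 2 + average e V z.1

/-- The gradient of a function on the torus. -/
def torusGrad (f : T2 → ℝ) (x : T2) : E2 := gradient (fun v : E2 => f (x + proj v)) 0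

/-- The Hamiltonian vector field `(∂_ξ p, -∂_x p)` of a function on the cotangent bundle. -/
def hamField (p : CotT2 → ℝ) (z : CotT2) : E2 × E2 :=
  (gradient (fun η : E2 => p (z.1, η)) z.2, -torusGrad (fun y => p (y, z.2)) z.1)

/-- `w = (u, ξ)` describes the integral curve `t ↦ (x₀ + u(t), ξ(t))` of the Hamiltonian vector
field of `p` that starts from `z₀ = (x₀, ξ₀)`. Here `u` is the displacement in the plane. -/
def IsTrajectory (p : CotT2 → ℝ) (z₀ : CotT2) (w : ℝ → E2 × E2) : Prop :=
  w 0 = (0, z₀.2) ∧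
    ∀ t : ℝ, HasDerivAt w (hamField p (z₀.1 + proj (w t).1, (w t).2)) t

/-- Through every point there is exactly one integral curve, and it exists for all times. -/
def FlowIsComplete (p : CotT2 → ℝ) : Prop := ∀ z₀ : CotT2, ∃! w, IsTrajectory p z₀ w

/-- The Hamiltonian flow of `p`. -/
def hamFlow (p : CotT2 → ℝ) (hp : FlowIsComplete p) (t : ℝ) (z : CotT2) : CotT2 :=
  (z.1 + proj ((hp z).choose t).1, ((hp z).choose t).2)

/-! Completeness of the two flows. -/

theorem proj_add (u v : E2) : proj (u + v) = proj u + proj v := by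
  funext i; simp [proj]

theorem proj_surjective (x : T2) : ∃ v : E2, proj v = x := by
  choose f hf using fun i => QuotientAddGroup.mk_surjective (x i)
  exact ⟨WithLp.toLp 2 f, funext hf⟩

theorem proj_intVec (k : Fin 2 → ℤ) : proj (intVec k) = 0 := by
  funext i
  simp only [proj, intVec, Pi.zero_apply]
  exact (AddCircle.coe_eq_zero_iff (1 : ℝ)).2 ⟨k i, by simp⟩

theorem proj_zero : proj 0 = 0 := by
  funext i; simp [proj]

/-- A globally Lipschitz `C¹` vector field has exactly one global integral curve through each
point. -/
theorem existsUnique_integralCurve {E : Type*} [NormedAddCommGroup E] [NormedSpace ℝ E]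
    [CompleteSpace E] (F : E → E) (hF : ContDiff ℝ 1 F) (K : NNReal) (hK : LipschitzWith K F)
    (w₀ : E) : ∃! w : ℝ → E, w 0 = w₀ ∧ ∀ t, HasDerivAt w (F (w t)) t := by
  have hex : ∃ w : ℝ → E, w 0 = w₀ ∧ IsMIntegralCurve (I := modelWithCornersSelf ℝ E) w F := by
    have hε : (0 : ℝ) < 1 / (2 * (K + 1)) := by positivity
    refine exists_isMIntegralCurve_of_isMIntegralCurveOn
      (contMDiff_vectorSpace_iff_contDiff.2 hF) hε (fun x => ?_) w₀
    set ε : ℝ := 1 / (2 * (K + 1)) with hεdef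
    have h0 : (0 : ℝ) ∈ Set.Icc (-ε) ε := ⟨by linarith, hε.le⟩
    set a : NNReal := ‖F x‖₊ / (K + 1) with ha
    have hPL : IsPicardLindelof (fun _ => F) (⟨0, h0⟩ : Set.Icc (-ε) ε) x a 0
        (‖F x‖₊ + K * a) K := by
      refine ⟨fun _ _ => hK.lipschitzOnWith, fun _ _ => continuousOn_const, ?_, ?_⟩
      · intro _ _ y hy
        have h1 := hK.dist_le_mul y x
        have h2 : dist y x ≤ a := hy
        rw [dist_eq_norm] at h1
        have h3 : ‖F y‖ ≤ ‖F x‖ + ‖F y - F x‖ := by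
          have := norm_add_le (F x) (F y - F x); simpa using this
        have h4 : (K : ℝ) * dist y x ≤ K * a := by gcongr
        simp only [NNReal.coe_add, NNReal.coe_mul, coe_nnnorm]
        linarith
      · have hmax : max (ε - 0) (0 - -ε) = ε := by simp
        change ((‖F x‖₊ + K * a : NNReal) : ℝ) * max (ε - 0) (0 - -ε) ≤ (a : ℝ) - ((0 : NNReal) : ℝ)
        rw [hmax, ha, hεdef]
        simp only [NNReal.coe_add, NNReal.coe_mul, NNReal.coe_div, NNReal.coe_one,
          NNReal.coe_zero, coe_nnnorm]
        have hK0 : (0 : ℝ) ≤ K := K.2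
        have hn := norm_nonneg (F x)
        have e1 : (‖F x‖ + K * (‖F x‖ / (K + 1))) * (1 / (2 * ((K : ℝ) + 1)))
            = ‖F x‖ / (K + 1) * ((2 * K + 1) / (2 * ((K : ℝ) + 1))) := by
          field_simp; ring
        rw [e1, sub_zero]
        refine mul_le_of_le_one_right (by positivity) ?_
        rw [div_le_one (by positivity)]
        linarith
    obtain ⟨α, hα0, hα⟩ := hPL.exists_eq_forall_mem_Icc_hasDerivWithinAt₀
    refine ⟨α, hα0, fun t ht => ?_⟩
    have h1 : HasDerivAt α (F (α t)) t :=
      (hα t ⟨ht.1.le, ht.2.le⟩).hasDerivAt (Icc_mem_nhds ht.1 ht.2)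
    exact h1.hasFDerivAt.hasMFDerivAt.hasMFDerivWithinAt
  obtain ⟨w, hw0, hw⟩ := hex
  refine ⟨w, ⟨hw0, fun t => ?_⟩, ?_⟩
  · have h1 : HasFDerivAt w (ContinuousLinearMap.smulRight (1 : ℝ →L[ℝ] ℝ) (F (w t))) t :=
        hasMFDerivAt_iff_hasFDerivAt.1 (hw t)
    simpa using h1.hasDerivAt
  · rintro w' ⟨h0, h1⟩
    refine ODE_solution_unique_univ (v := fun _ => F) (s := fun _ => Set.univ) (t₀ := 0) (K := K)
      (fun _ => hK.lipschitzOnWith) (fun t => ⟨h1 t, trivial⟩) (fun t => ⟨?_, trivial⟩) ?_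
    · have h2 : HasFDerivAt w (ContinuousLinearMap.smulRight (1 : ℝ →L[ℝ] ℝ) (F (w t))) t :=
        hasMFDerivAt_iff_hasFDerivAt.1 (hw t)
      simpa using h2.hasDerivAt
    · rw [h0, hw0]

theorem flowIsComplete_of_lipschitz (p : CotT2 → ℝ)
    (h : ∀ x₀ : T2, ContDiff ℝ 1 (fun w : E2 × E2 => hamField p (x₀ + proj w.1, w.2)) ∧
      ∃ K, LipschitzWith K (fun w : E2 × E2 => hamField p (x₀ + proj w.1, w.2))) :
    FlowIsComplete p := by
  intro z₀
  obtain ⟨h1, K, hK⟩ := h z₀.1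
  exact existsUnique_integralCurve _ h1 K hK (0, z₀.2)

theorem hasGradientAt_inner (c a : E2) (b : ℝ) :
    HasGradientAt (fun η : E2 => b * inner ℝ η c) (b • c) a := by
  rw [hasGradientAt_iff_hasFDerivAt]
  have h := (((innerSL ℝ c).hasFDerivAt (x := a)).const_mul b)
  have e1 : (fun η : E2 => b * inner ℝ η c) = fun η : E2 => b * (innerSL ℝ c) η := by
    funext η; simp [real_inner_comm]
  rw [e1]
  refine h.congr_fderiv ?_
  ext v
  simp

theorem flowIsComplete_HamPerp (e : Fin 2 → ℤ) : FlowIsComplete (HamPerp e) := by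
  refine flowIsComplete_of_lipschitz _ fun x₀ => ?_
  have h : (fun w : E2 × E2 => hamField (HamPerp e) (x₀ + proj w.1, w.2))
      = fun _ => ((1 / len e) • intVec (perp e), (0 : E2)) := by
    funext w
    refine Prod.ext ?_ ?_
    · exact (hasGradientAt_inner (intVec (perp e)) w.2 (1 / len e)).gradient
    · simp only [hamField, torusGrad, HamPerp]
      rw [gradient_fun_const, neg_zero]
  rw [h]
  exact ⟨contDiff_const, 0, LipschitzWith.const _⟩

/-- Periodicity with respect to `ℤ²`. -/
def IsPeriodic {F : Type*} (f : E2 → F) : Prop := ∀ (k : Fin 2 → ℤ) (u : E2), f (u + intVec k) = f u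

theorem IsPeriodic.bounded {F : Type*} [NormedAddCommGroup F] {f : E2 → F} (hp : IsPeriodic f)
    (hf : Continuous f) : ∃ C : NNReal, ∀ u, ‖f u‖₊ ≤ C := by
  obtain ⟨C, hC⟩ := (isCompact_closedBall (0 : E2) 2).exists_bound_of_continuousOn hf.continuousOn
  refine ⟨C.toNNReal, fun u => ?_⟩
  rw [← NNReal.coe_le_coe, coe_nnnorm]
  refine le_trans ?_ (Real.le_coe_toNNReal C)
  have h1 := hp (fun i => -⌊u i⌋) u
  rw [← h1]
  apply hC
  rw [mem_closedBall_zero_iff, EuclideanSpace.norm_eq, Real.sqrt_le_left (by norm_num)]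
  have key : ∀ i, ‖(u + intVec (fun i => -⌊u i⌋)) i‖ ^ 2 ≤ 1 := by
    intro i
    have e1 : (u + intVec (fun i => -⌊u i⌋)) i = Int.fract (u i) := by
      simp [intVec, Int.fract, sub_eq_add_neg]
    rw [e1, Real.norm_eq_abs, sq_abs]
    have h2 := Int.fract_nonneg (u i)
    have h3 := (Int.fract_lt_one (u i)).le
    nlinarith
  rw [Fin.sum_univ_two]
  linarith [key 0, key 1]

theorem IsPeriodic.fderiv {F : Type*} [NormedAddCommGroup F] [NormedSpace ℝ F] {f : E2 → F}
    (hp : IsPeriodic f) : IsPeriodic (fderiv ℝ f) := by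
  intro k u
  rw [← fderiv_comp_add_right]
  congr 1
  exact funext (hp k)

theorem contDiff_integral_periodic (n : ℕ) : ∀ {F : Type} [NormedAddCommGroup F] [NormedSpace ℝ F]
    (f : E2 → F), ContDiff ℝ n f → IsPeriodic f → ∀ (T : ℝ) (c : E2),
    ContDiff ℝ n (fun u : E2 => ∫ s in (0 : ℝ)..T, f (u + (s / T) • c)) := by
  induction n with
  | zero =>
    intro F _ _ f hf _ T c
    have hc : Continuous f := hf.continuous
    refine contDiff_zero.2 ?_
    exact intervalIntegral.continuous_parametric_intervalIntegral_of_continuous' (by fun_prop) 0 T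
  | succ n ih =>
    intro F _ _ f hf hp T c
    have hf' : ContDiff ℝ n (fderiv ℝ f) := hf.fderiv_right (by norm_cast)
    have hd : Differentiable ℝ f := hf.differentiable (by norm_cast)
    have hc : Continuous f := hf.continuous
    have hc' : Continuous (fderiv ℝ f) := hf'.continuous
    push_cast
    refine contDiff_succ_iff_hasFDerivAt.2 ⟨_, ih (fderiv ℝ f) hf' hp.fderiv T c, fun u => ?_⟩
    obtain ⟨C, hC⟩ := hp.fderiv.bounded hc'
    refine intervalIntegral.hasFDerivAt_integral_of_dominated_of_fderiv_le
      (F := fun u s => f (u + (s / T) • c)) (F' := fun u s => fderiv ℝ f (u + (s / T) • c))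
      (bound := fun _ => (C : ℝ)) Filter.univ_mem ?_ ?_ ?_ ?_ ?_ ?_
    · exact Filter.Eventually.of_forall fun v =>
        (Continuous.aestronglyMeasurable (by fun_prop))
    · exact Continuous.intervalIntegrable (by fun_prop) _ _
    · exact Continuous.aestronglyMeasurable (by fun_prop)
    · exact Filter.Eventually.of_forall fun s _ v _ => hC _
    · exact intervalIntegrable_const
    · refine Filter.Eventually.of_forall fun s _ v _ => ?_
      exact (hasFDerivAt_comp_add_right ((s / T) • c)).2 (hd _).hasFDerivAt

theorem average_lift (e : Fin 2 → ℤ) (V : T2 → ℝ) (u : E2) :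
    average e V (proj u) = (1 / len e) * ∫ s in (0 : ℝ)..(len e),
      (fun v : E2 => V (proj v)) (u + (s / len e) • intVec (perp e)) := by
  simp only [average, proj_add]

theorem flowIsComplete_pHam (e : Fin 2 → ℤ) (V : T2 → ℝ) (hV : SmoothOnTorus V) :
    FlowIsComplete (pHam e V) := by
  refine flowIsComplete_of_lipschitz _ fun x₀ => ?_
  obtain ⟨a, rfl⟩ := proj_surjective x₀
  have hper : IsPeriodic (fun v : E2 => V (proj v)) := by
    intro k u; simp only [proj_add, proj_intVec, add_zero]
  set J : E2 → ℝ := fun u => average e V (proj (a + u)) with hJ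
  have hJs : ContDiff ℝ 2 J := by
    have h1 := contDiff_integral_periodic 2 _ (contDiff_infty.1 hV 2) hper (len e)
      (intVec (perp e))
    have h2 : ContDiff ℝ 2 (fun u : E2 => average e V (proj u)) := by
      simp only [average_lift]
      exact contDiff_const.mul (by exact_mod_cast h1)
    exact h2.comp (contDiff_const.add contDiff_id)
  have hJp : IsPeriodic J := by
    intro k u; simp only [hJ, proj_add, proj_intVec, add_zero]
  set D : E2 → E2 →L[ℝ] ℝ := fderiv ℝ J with hD
  have hDs : ContDiff ℝ 1 D := hJs.fderiv_right (by norm_num)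
  obtain ⟨C, hC⟩ := hJp.fderiv.fderiv.bounded
    ((hDs.fderiv_right (m := 0) (by norm_num)).continuous)
  have hDl : LipschitzWith C D := lipschitzWith_of_nnnorm_fderiv_le
    (hDs.differentiable (by norm_num)) hC
  let c : E2 := intVec e
  let A : E2 →L[ℝ] E2 := ((1 / len e) • innerSL ℝ c).smulRight ((1 / len e) • c)
  have hfield : (fun w : E2 × E2 => hamField (pHam e V) (proj a + proj w.1, w.2))
      = fun w => (A w.2, -(InnerProductSpace.toDual ℝ E2).symm (D w.1)) := by
    funext w
    refine Prod.ext ?_ ?_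
    · refine HasGradientAt.gradient ?_
      rw [hasGradientAt_iff_hasFDerivAt]
      have h1 := hasGradientAt_iff_hasFDerivAt.1 (hasGradientAt_inner c w.2 (1 / len e))
      have h2 := ((h1.pow 2).mul_const (1 / 2 : ℝ)).add_const (average e V (proj a + proj w.1))
      have e1 : (fun η : E2 => pHam e V (proj a + proj w.1, η))
          = fun η => (1 / len e * inner ℝ η c) ^ 2 * (1 / 2 : ℝ)
            + average e V (proj a + proj w.1) := by
        funext η; simp only [pHam, Ham, c]; ring
      simp only [e1]
      refine h2.congr_fderiv ?_
      ext v
      simp [A, real_inner_comm]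
      ring
    · change -torusGrad _ _ = _
      congr 1
      simp only [torusGrad, gradient]
      congr 1
      have e1 : (fun v : E2 => pHam e V (proj a + proj w.1 + proj v, w.2))
          = fun v => Ham e (proj a, w.2) ^ 2 / 2 + J (w.1 + v) := by
        funext v; simp only [pHam, Ham, hJ, proj_add, add_assoc]
      simp only [e1]
      rw [fderiv_const_add, fderiv_comp_add_left, add_zero]
  rw [hfield]
  refine ⟨?_, ?_⟩
  · refine ContDiff.prodMk (A.contDiff.comp contDiff_snd) (ContDiff.neg ?_)
    exact (InnerProductSpace.toDual ℝ E2).symm.contDiff.comp (hDs.comp contDiff_fst)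
  · exact ⟨_, (A.lipschitz.comp LipschitzWith.prod_snd).prodMk
      (((InnerProductSpace.toDual ℝ E2).symm.lipschitz.comp
        (hDl.comp LipschitzWith.prod_fst)).neg)⟩

/-! The flows, the critical set and the regular set. -/

/-- The Hamiltonian flow of `H^⊥`. -/
def flowHamPerp (e : Fin 2 → ℤ) : ℝ → CotT2 → CotT2 :=
  hamFlow (HamPerp e) (flowIsComplete_HamPerp e)

/-- The Hamiltonian flow of `p`. -/
def flowP (e : Fin 2 → ℤ) (V : T2 → ℝ) (hV : SmoothOnTorus V) : ℝ → CotT2 → CotT2 :=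
  hamFlow (pHam e V) (flowIsComplete_pHam e V hV)

/-- The critical set: zero momentum along `e` at a critical point of the averaged potential. -/
def critSet (e : Fin 2 → ℤ) (V : T2 → ℝ) : Set CotT2 :=
  {z | Ham e z = 0 ∧ torusGrad (average e V) z.1 = 0}

/-- The regular set, the complement of the critical set. -/
def regularSet (e : Fin 2 → ℤ) (V : T2 → ℝ) : Set CotT2 := (critSet e V)ᶜ

/-- A measure on the regular set, regarded as a measure on the cotangent bundle, is invariant under
all the maps of a flow. -/
def IsFlowInvariant {R : Set CotT2} (μ : Measure R) (φ : ℝ → CotT2 → CotT2) : Prop :=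
  ∀ t : ℝ, MeasurePreserving (φ t) (μ.map Subtype.val) (μ.map Subtype.val)

end

end BiInv

/-! Each orbit of the joint `ℝ²`-action of the two flows projects to the torus as
`(t, s) ↦ x₀ + c(t) e + (s / L) e^⊥`. On a trajectory of `p` in the regular set, the momentum `c'`
along `e` has only simple zeros: at a double zero the vector field of `p` would vanish, so that the
trajectory would be a critical equilibrium. Hence `c' ≠ 0` almost everywhere, and the projected
orbit map pulls Lebesgue null sets back to null sets. By invariance and Fubini, the measure of the
fibre over a null set of the torus is the mean over an orbit of such null sets, hence zero. -/

namespace BiInv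

open Set Function
open scoped NNReal

section AbsolutelyContinuous

theorem absolutelyContinuous_of_ae_quasiMeasurePreserving {Q X Y : Type*} [MeasurableSpace Q]
    [MeasurableSpace X] [MeasurableSpace Y] {κ : Measure Q} [SFinite κ] [NeZero κ] {μ : Measure X}
    [SFinite μ] {ρ σ : Measure Y} {f : Q → X → Y} (hf : Measurable (uncurry f))
    (hρ : ∀ᵐ q ∂κ, ρ ≪ μ.map (f q))
    (hσ : ∀ᵐ x ∂μ, Measure.QuasiMeasurePreserving (fun q => f q x) κ σ) : ρ ≪ σ := by
  refine Measure.AbsolutelyContinuous.mk fun N hN hN0 => ?_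
  have hfiber : ∀ᵐ q ∂κ, ∀ᵐ x ∂μ, f q x ∉ N :=
    (Measure.ae_ae_comm (hf hN).compl).2 <| hσ.mono fun x hx =>
      measure_eq_zero_iff_ae_notMem.1 (hx.preimage_null hN0)
  obtain ⟨q, hρq, hq⟩ := (hρ.and hfiber).exists
  exact hρq <| (Measure.map_apply hf.of_uncurry_left hN).trans <|
    measure_eq_zero_iff_ae_notMem.2 hq

theorem map_comp_comp_of_measurePreserving_map {Ω X Y : Type*} [MeasurableSpace Ω]
    [MeasurableSpace X] [MeasurableSpace Y] {μ : Measure Ω} {f : Ω → X} (hf : Measurable f)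
    {φ : X → X} (hφ : MeasurePreserving φ (μ.map f) (μ.map f)) {g : X → Y} (hg : Measurable g) :
    μ.map (g ∘ φ ∘ f) = μ.map (g ∘ f) := by
  rw [← Measure.map_map hg (hφ.measurable.comp hf), ← Measure.map_map hφ.measurable hf, hφ.map_eq,
    Measure.map_map hg hf]

variable {E : Type*} [NormedAddCommGroup E] [NormedSpace ℝ E] [FiniteDimensional ℝ E]
  [MeasurableSpace E] [BorelSpace E] (μ : Measure E) [μ.IsAddHaarMeasure]

theorem addHaar_eq_zero_of_addHaar_image_eq_zero {f : E → E} {f' : E → E →L[ℝ] E} {s : Set E}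
    (hf : ∀ x ∈ s, HasFDerivWithinAt f (f' x) s x) (hdet : ∀ x ∈ s, (f' x).det ≠ 0)
    (hs : μ (f '' s) = 0) : μ s = 0 := by
  rcases s.eq_empty_or_nonempty with rfl | hne
  · exact measure_empty
  have hlinear (A : E →L[ℝ] E) : ∃ δ : ℝ≥0, δ ≠ 0 ∧ (A.det ≠ 0 → ∀ t : Set E,
      ApproximatesLinearOn f A t δ → μ (f '' t) = 0 → μ t = 0) := by
    by_cases hA : A.det = 0
    · exact ⟨1, one_ne_zero, fun h => (h hA).elim⟩
    obtain ⟨m, hm0, hm⟩ := ENNReal.lt_iff_exists_nnreal_btwn.1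
      (ENNReal.ofReal_pos.2 (abs_pos.2 hA))
    obtain ⟨δ, hδ, hδ0⟩ :=
      ((mul_le_addHaar_image_of_lt_det μ A hm).and self_mem_nhdsWithin).exists
    refine ⟨δ, hδ0.ne', fun _ t ht ht0 => ?_⟩
    have hle := ht0 ▸ hδ t f ht
    exact (mul_eq_zero.1 (nonpos_iff_eq_zero.1 hle)).resolve_left hm0.ne'
  choose δ hδ0 hδ using hlinear
  obtain ⟨t, A, -, -, hst, happrox, hA⟩ :=
    exists_partition_approximatesLinearOn_of_hasFDerivWithinAt f s f' hf δ hδ0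
  have hpiece (n : ℕ) : μ (s ∩ t n) = 0 := by
    obtain ⟨x, hx, hAx⟩ := hA hne n
    exact hδ (A n) (hAx ▸ hdet x hx) _ (happrox n)
      (measure_mono_null (image_mono inter_subset_left) hs)
  rw [← inter_eq_left.2 hst, inter_iUnion]
  exact measure_iUnion_null hpiece

theorem volume_eq_zero_of_volume_image_eq_zero {f f' : ℝ → ℝ} {s : Set ℝ}
    (hf : ∀ x ∈ s, HasDerivWithinAt f (f' x) s x) (hf' : ∀ x ∈ s, f' x ≠ 0)
    (hs : volume (f '' s) = 0) : volume s = 0 :=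
  addHaar_eq_zero_of_addHaar_image_eq_zero volume (fun x hx => (hf x hx).hasFDerivWithinAt)
    (fun x hx => by simpa only [ContinuousLinearMap.det_toSpanSingleton] using hf' x hx) hs

theorem ae_ne_of_hasDerivAt {f f' : ℝ → ℝ} {c : ℝ} (hf : ∀ x, HasDerivAt f (f' x) x)
    (hf' : ∀ x, f x = c → f' x ≠ 0) : ∀ᵐ x, f x ≠ c := by
  have himage : f '' {x | f x = c} ⊆ {c} := by
    rintro _ ⟨x, hx, rfl⟩
    exact hx
  exact measure_eq_zero_iff_ae_notMem.1 <|
    volume_eq_zero_of_volume_image_eq_zero (s := {x | f x = c})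
      (fun x _ => (hf x).hasDerivWithinAt) hf' (measure_mono_null himage (measure_singleton c))

theorem quasiMeasurePreserving_of_hasDerivAt {f f' : ℝ → ℝ} (hf : ∀ x, HasDerivAt f (f' x) x)
    (hf' : ∀ᵐ x, f' x ≠ 0) : Measure.QuasiMeasurePreserving f := by
  have hfm : Measurable f :=
    (continuous_iff_continuousAt.2 fun x => (hf x).continuousAt).measurable
  refine ⟨hfm, Measure.AbsolutelyContinuous.mk fun N hN hN0 => ?_⟩
  have hregular : volume (f ⁻¹' N ∩ {x | f' x ≠ 0}) = 0 :=
    volume_eq_zero_of_volume_image_eq_zero (fun x _ => (hf x).hasDerivWithinAt) (fun x hx => hx.2)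
      (measure_mono_null (image_subset_iff.2 inter_subset_left) hN0)
  rw [Measure.map_apply hfm hN]
  exact (measure_inter_conull hf').symm.trans hregular

end AbsolutelyContinuous

theorem quasiMeasurePreserving_linearMap_of_surjective {E F : Type*} [NormedAddCommGroup E]
    [NormedSpace ℝ E] [FiniteDimensional ℝ E] [MeasurableSpace E] [BorelSpace E]
    [NormedAddCommGroup F] [NormedSpace ℝ F] [MeasurableSpace F] [BorelSpace F]
    {L : E →ₗ[ℝ] F} (hL : Surjective L) (μ : Measure E) [μ.IsAddHaarMeasure] (ν : Measure F)
    [ν.IsAddHaarMeasure] : Measure.QuasiMeasurePreserving L μ ν := by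
  obtain ⟨c, -, hc⟩ := L.exists_map_addHaar_eq_smul_addHaar μ ν hL
  exact ⟨L.continuous_of_finiteDimensional.measurable,
    hc ▸ Measure.smul_absolutelyContinuous⟩

theorem quasiMeasurePreserving_addCircle_mk (T : ℝ) [Fact (0 < T)] :
    Measure.QuasiMeasurePreserving (fun x : ℝ => (x : AddCircle T)) := by
  refine ⟨AddCircle.measurable_mk', Measure.AbsolutelyContinuous.mk fun N hN hN0 => ?_⟩
  rw [Measure.map_apply AddCircle.measurable_mk' hN, measure_eq_zero_iff_ae_notMem,
    ← Measure.restrict_univ (μ := volume), ← iUnion_Ioc_add_zsmul (Fact.out : 0 < T) 0,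
    ae_restrict_iUnion_iff]
  intro n
  have hperiod := (AddCircle.measurePreserving_mk T (0 + n • T)).quasiMeasurePreserving
  rw [add_one_zsmul, ← add_assoc]
  exact measure_eq_zero_iff_ae_notMem.1 (hperiod.preimage_null hN0)

theorem quasiMeasurePreserving_proj : Measure.QuasiMeasurePreserving proj := by
  have hmk := quasiMeasurePreserving_addCircle_mk 1
  have hproj := (volume_preserving_finTwoArrow UnitAddCircle).symm.quasiMeasurePreserving.comp <|
    (MeasureTheory.QuasiMeasurePreserving.prodMap hmk hmk).comp
      ((volume_preserving_finTwoArrow ℝ).comp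
        (PiLp.volume_preserving_ofLp (Fin 2))).quasiMeasurePreserving
  convert! hproj using 1
  funext v i
  fin_cases i <;> rfl

section Frame

variable {e : Fin 2 → ℤ}

theorem intVec_ne_zero (he : e ≠ 0) : intVec e ≠ 0 := fun h =>
  he <| funext fun i => by simpa [intVec] using congrArg (fun v : E2 => v i) h

theorem len_pos (he : e ≠ 0) : 0 < len e := norm_pos_iff.2 (intVec_ne_zero he)

theorem len_sq (e : Fin 2 → ℤ) : len e ^ 2 = (e 0 : ℝ) ^ 2 + (e 1 : ℝ) ^ 2 := by
  simp [len, intVec, EuclideanSpace.norm_sq_eq]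

/-- For `e ≠ 0`, the coordinate along `e` of a vector of the plane in the orthogonal frame
`(e, e^⊥)`; the coordinate along `e^⊥` is `frameCoord (perp e)`. -/
noncomputable def frameCoord (e : Fin 2 → ℤ) : E2 →L[ℝ] ℝ := (len e ^ 2)⁻¹ • innerSL ℝ (intVec e)

theorem frameCoord_apply (e : Fin 2 → ℤ) (u : E2) :
    frameCoord e u = (len e ^ 2)⁻¹ * inner ℝ (intVec e) u := rfl

/-- The parametrisation of the plane by the coordinates in the frame `(e, e^⊥)`. -/
noncomputable def frame (e : Fin 2 → ℤ) : ℝ × ℝ →ₗ[ℝ] E2 :=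
  (LinearMap.toSpanSingleton ℝ E2 (intVec e)).coprod
    (LinearMap.toSpanSingleton ℝ E2 (intVec (perp e)))

theorem frame_apply (e : Fin 2 → ℤ) (a b : ℝ) :
    frame e (a, b) = a • intVec e + b • intVec (perp e) := rfl

theorem frame_frameCoord (he : e ≠ 0) (u : E2) :
    frame e (frameCoord e u, frameCoord (perp e) u) = u := by
  have hlen : (e 0 : ℝ) ^ 2 + (e 1 : ℝ) ^ 2 ≠ 0 := len_sq e ▸ pow_ne_zero 2 (len_pos he).ne'
  have hlen' : (e 1 : ℝ) ^ 2 + (e 0 : ℝ) ^ 2 ≠ 0 := by rwa [add_comm]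
  ext i
  fin_cases i <;>
    simp only [frame_apply, frameCoord_apply, len_sq, intVec, perp, PiLp.inner_apply,
      RCLike.inner_apply, map_intCast, Fin.sum_univ_two, Fin.isValue, Fin.zero_eta, Fin.mk_one,
      Matrix.cons_val_zero, Matrix.cons_val_one, Matrix.cons_val_fin_one, Int.cast_neg, even_two,
      Even.neg_pow, mul_neg, PiLp.add_apply, PiLp.smul_apply, smul_eq_mul] <;>
    field_simp <;> ring

theorem frame_surjective (he : e ≠ 0) : Surjective (frame e) := fun u =>
  ⟨_, frame_frameCoord he u⟩

theorem frameCoord_intVec_self (he : e ≠ 0) : frameCoord e (intVec e) = 1 := by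
  rw [frameCoord_apply, real_inner_self_eq_norm_sq]
  exact inv_mul_cancel₀ (pow_ne_zero 2 (len_pos he).ne')

theorem frameCoord_perp_intVec (e : Fin 2 → ℤ) : frameCoord (perp e) (intVec e) = 0 := by
  simp [frameCoord_apply, intVec, perp, PiLp.inner_apply, mul_comm]

theorem Ham_eq_len_mul_frameCoord (he : e ≠ 0) (z : CotT2) :
    Ham e z = len e * frameCoord e z.2 := by
  have := (len_pos he).ne'
  rw [Ham, frameCoord_apply, real_inner_comm]
  field_simp

end Frame

section Average

variable {e : Fin 2 → ℤ} {V : T2 → ℝ}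

theorem average_add_perp (he : e ≠ 0) (V : T2 → ℝ) (x : T2) (r : ℝ) :
    average e V (x + proj (r • intVec (perp e))) = average e V x := by
  have hl := (len_pos he).ne'
  set g : ℝ → ℝ := fun s => V (x + proj ((s / len e) • intVec (perp e))) with hg
  have hper : Periodic g (len e) := fun s => by
    simp only [hg, add_div, div_self hl, add_smul, one_smul, proj_add, proj_intVec, add_zero]
  have hshift (s : ℝ) : V (x + proj (r • intVec (perp e)) +
      proj ((s / len e) • intVec (perp e))) = g (s + r * len e) := by
    simp only [hg, add_div, mul_div_cancel_right₀ _ hl, add_smul, proj_add]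
    rw [add_assoc, add_comm (proj (r • _))]
  simp only [average, hshift]
  rw [intervalIntegral.integral_comp_add_right, zero_add, add_comm (len e),
    hper.intervalIntegral_add_eq (r * len e) 0, zero_add]

theorem SmoothOnTorus.differentiable_average (hV : SmoothOnTorus V) (e : Fin 2 → ℤ) :
    Differentiable ℝ fun v => average e V (proj v) := by
  have hper : IsPeriodic fun v => V (proj v) := fun k u => by
    simp only [proj_add, proj_intVec, add_zero]
  simp only [average_lift]
  exact ((contDiff_integral_periodic 1 _ (contDiff_infty.1 hV 1) hper (len e)
    (intVec (perp e))).differentiable one_ne_zero).const_mul _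

theorem frameCoord_perp_torusGrad_average (he : e ≠ 0)
    (hV : Differentiable ℝ fun v => average e V (proj v)) (x : T2) :
    frameCoord (perp e) (torusGrad (average e V) x) = 0 := by
  obtain ⟨a, rfl⟩ := proj_surjective x
  have hdiff : DifferentiableAt ℝ (fun v => average e V (proj a + proj v)) 0 := by
    simp only [← proj_add]
    exact (hV _).comp 0 (by fun_prop)
  have hline : lineDeriv ℝ (fun v => average e V (proj a + proj v)) 0 (intVec (perp e)) = 0 := by
    simp only [lineDeriv, zero_add, average_add_perp he, deriv_const]
  rw [hdiff.lineDeriv_eq_fderiv] at hline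
  rw [frameCoord_apply, torusGrad, real_inner_comm, gradient, InnerProductSpace.toDual_symm_apply,
    hline, mul_zero]

end Average

theorem continuous_proj : Continuous proj :=
  continuous_pi fun _ => (AddCircle.continuous_mk' 1).comp (by fun_prop)

section HamiltonianFlow

variable {p : CotT2 → ℝ} {z : CotT2} {w : ℝ → E2 × E2}

theorem IsTrajectory.shift (hw : IsTrajectory p z w) (t : ℝ) :
    IsTrajectory p (z.1 + proj (w t).1, (w t).2) fun s => w (s + t) - ((w t).1, 0) := by
  refine ⟨by ext <;> simp, fun s => ?_⟩
  have hderiv := ((hw.2 (s + t)).comp_add_const s t).sub_const ((w t).1, (0 : E2))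
  simpa only [Prod.fst_sub, Prod.snd_sub, sub_zero, add_assoc, ← proj_add, add_sub_cancel]
    using hderiv

theorem isTrajectory_of_hamField_eq_zero (hz : hamField p z = 0) :
    IsTrajectory p z fun _ => (0, z.2) := by
  refine ⟨rfl, fun t => ?_⟩
  simpa only [proj_zero, add_zero, hz] using hasDerivAt_const t ((0 : E2), z.2)

variable (hp : FlowIsComplete p)

theorem IsTrajectory.hamFlow_eq (hw : IsTrajectory p z w) (t : ℝ) :
    hamFlow p hp t z = (z.1 + proj (w t).1, (w t).2) := by
  rw [hamFlow, ← (hp z).choose_spec.2 w hw]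

theorem hamFlow_zero (z : CotT2) : hamFlow p hp 0 z = z := by
  obtain ⟨w, hw, -⟩ := hp z
  rw [hw.hamFlow_eq, hw.1, proj_zero, add_zero]

theorem hamFlow_hamFlow (s t : ℝ) (z : CotT2) :
    hamFlow p hp s (hamFlow p hp t z) = hamFlow p hp (s + t) z := by
  obtain ⟨w, hw, -⟩ := hp z
  rw [hw.hamFlow_eq hp t, (hw.shift t).hamFlow_eq, hw.hamFlow_eq]
  simp only [Prod.fst_sub, Prod.snd_sub, sub_zero, add_assoc, ← proj_add, add_sub_cancel]

theorem hamFlow_of_hamField_eq_zero (hz : hamField p z = 0) (t : ℝ) : hamFlow p hp t z = z := by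
  rw [(isTrajectory_of_hamField_eq_zero hz).hamFlow_eq, proj_zero, add_zero]

theorem hamFlow_eq_self_of_hamField_hamFlow_eq_zero {t : ℝ}
    (h : hamField p (hamFlow p hp t z) = 0) : hamFlow p hp t z = z := by
  rw [← hamFlow_of_hamField_eq_zero hp h (-t), hamFlow_hamFlow, neg_add_cancel, hamFlow_zero]

theorem continuous_hamFlow (z : CotT2) : Continuous fun t => hamFlow p hp t z := by
  obtain ⟨w, hw, -⟩ := hp z
  have hwc : Continuous w := continuous_iff_continuousAt.2 fun t => (hw.2 t).continuousAt
  simp only [hw.hamFlow_eq hp]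
  exact (continuous_const.add (continuous_proj.comp hwc.fst)).prodMk hwc.snd

theorem measurable_uncurry_hamFlow (h : ∀ t, Measurable (hamFlow p hp t)) :
    Measurable (uncurry (hamFlow p hp)) :=
  measurable_uncurry_of_continuous_of_measurable (continuous_hamFlow hp) h

end HamiltonianFlow

theorem hamField_HamPerp (e : Fin 2 → ℤ) (z : CotT2) :
    hamField (HamPerp e) z = ((1 / len e) • intVec (perp e), 0) := by
  refine Prod.ext (hasGradientAt_inner (intVec (perp e)) z.2 (1 / len e)).gradient ?_
  simp only [hamField, torusGrad, HamPerp]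
  rw [gradient_fun_const, neg_zero]

theorem flowHamPerp_apply (e : Fin 2 → ℤ) (t : ℝ) (z : CotT2) :
    flowHamPerp e t z = (z.1 + proj ((t / len e) • intVec (perp e)), z.2) := by
  have htraj : IsTrajectory (HamPerp e) z fun t => ((t / len e) • intVec (perp e), z.2) := by
    refine ⟨by simp, fun t => ?_⟩
    rw [hamField_HamPerp]
    exact (((hasDerivAt_id t).div_const (len e)).smul_const _).prodMk (hasDerivAt_const _ _)
  exact htraj.hamFlow_eq (flowIsComplete_HamPerp e) t

theorem measurable_flowHamPerp (e : Fin 2 → ℤ) (t : ℝ) : Measurable (flowHamPerp e t) := by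
  rw [funext (flowHamPerp_apply e t)]
  fun_prop

section FlowP

variable {e : Fin 2 → ℤ} {V : T2 → ℝ} {z : CotT2} {w : ℝ → E2 × E2}

theorem hamField_pHam (e : Fin 2 → ℤ) (V : T2 → ℝ) (z : CotT2) :
    hamField (pHam e V) z = (frameCoord e z.2 • intVec e, -torusGrad (average e V) z.1) := by
  refine Prod.ext ?_ ?_
  · refine HasGradientAt.gradient <| hasGradientAt_iff_hasFDerivAt.2 ?_
    have hHam := (hasGradientAt_inner (intVec e) z.2 (1 / len e)).hasFDerivAt
    have hsq := ((hHam.pow 2).const_mul 2⁻¹).add_const (average e V z.1)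
    simp only [← div_eq_inv_mul] at hsq
    refine hsq.congr_fderiv ?_
    ext v
    simp only [one_div, Nat.add_one_sub_one, pow_one, nsmul_eq_mul, Nat.cast_ofNat, map_smul,
      smul_apply, InnerProductSpace.toDual_apply_apply, real_inner_comm, smul_eq_mul,
      frameCoord_apply]
    ring
  · simp only [hamField, torusGrad, gradient, pHam, Ham, fderiv_const_add]

theorem mem_critSet_of_frameCoord_eq_zero (he : e ≠ 0)
    (hV : Differentiable ℝ fun v => average e V (proj v)) (hmomentum : frameCoord e z.2 = 0)
    (hforce : frameCoord e (torusGrad (average e V) z.1) = 0) : z ∈ critSet e V := by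
  refine ⟨by rw [Ham_eq_len_mul_frameCoord he, hmomentum, mul_zero], ?_⟩
  rw [← frame_frameCoord he (torusGrad (average e V) z.1), hforce,
    frameCoord_perp_torusGrad_average he hV]
  exact map_zero (frame e)

theorem hamField_pHam_of_mem_critSet (he : e ≠ 0) (hz : z ∈ critSet e V) :
    hamField (pHam e V) z = 0 := by
  have hmomentum : frameCoord e z.2 = 0 :=
    (mul_eq_zero.1 (Ham_eq_len_mul_frameCoord he z ▸ hz.1)).resolve_left (len_pos he).ne'
  rw [hamField_pHam, hmomentum, hz.2, zero_smul, neg_zero, Prod.mk_zero_zero]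

theorem hamFlow_mem_regularSet (he : e ≠ 0) (hp : FlowIsComplete (pHam e V))
    (hz : z ∈ regularSet e V) (t : ℝ) : hamFlow (pHam e V) hp t z ∈ regularSet e V := fun hcrit =>
  hz <| hamFlow_eq_self_of_hamField_hamFlow_eq_zero hp (hamField_pHam_of_mem_critSet he hcrit) ▸
    hcrit

namespace IsTrajectory

theorem hasDerivAt_frameCoord_fst (he : e ≠ 0) (hw : IsTrajectory (pHam e V) z w) (t : ℝ) :
    HasDerivAt (fun t => frameCoord e (w t).1) (frameCoord e (w t).2) t := by
  have hderiv := (frameCoord e).hasFDerivAt.comp_hasDerivAt t (hw.2 t).fst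
  rwa [hamField_pHam, map_smul, frameCoord_intVec_self he, smul_eq_mul, mul_one] at hderiv

theorem frameCoord_perp_fst (hw : IsTrajectory (pHam e V) z w) (t : ℝ) :
    frameCoord (perp e) (w t).1 = 0 := by
  have hderiv (t : ℝ) : HasDerivAt (fun t => frameCoord (perp e) (w t).1) 0 t := by
    have := (frameCoord (perp e)).hasFDerivAt.comp_hasDerivAt t (hw.2 t).fst
    rwa [hamField_pHam, map_smul, frameCoord_perp_intVec, smul_zero] at this
  have hconst := is_const_of_deriv_eq_zero (fun t => (hderiv t).differentiableAt)
    (fun t => (hderiv t).deriv) t 0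
  rwa [hw.1, map_zero] at hconst

theorem hasDerivAt_frameCoord_snd (hw : IsTrajectory (pHam e V) z w) (t : ℝ) :
    HasDerivAt (fun t => frameCoord e (w t).2)
      (-frameCoord e (torusGrad (average e V) (z.1 + proj (w t).1))) t := by
  have hderiv := (frameCoord e).hasFDerivAt.comp_hasDerivAt t (hw.2 t).snd
  rwa [hamField_pHam, map_neg] at hderiv

theorem ae_frameCoord_snd_ne_zero (he : e ≠ 0)
    (hV : Differentiable ℝ fun v => average e V (proj v)) (hp : FlowIsComplete (pHam e V))
    (hz : z ∈ regularSet e V) (hw : IsTrajectory (pHam e V) z w) :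
    ∀ᵐ t, frameCoord e (w t).2 ≠ 0 := by
  refine ae_ne_of_hasDerivAt hw.hasDerivAt_frameCoord_snd fun t hmomentum hforce => ?_
  have hregular := hamFlow_mem_regularSet he hp hz t
  rw [hw.hamFlow_eq] at hregular
  exact hregular (mem_critSet_of_frameCoord_eq_zero he hV hmomentum (neg_eq_zero.1 hforce))

theorem fst_flowHamPerp_hamFlow (he : e ≠ 0) (hp : FlowIsComplete (pHam e V))
    (hw : IsTrajectory (pHam e V) z w) (s t : ℝ) :
    (flowHamPerp e s (hamFlow (pHam e V) hp t z)).1 =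
      z.1 + proj (frame e (frameCoord e (w t).1, s / len e)) := by
  have hfst : (w t).1 = frameCoord e (w t).1 • intVec e := by
    conv_lhs => rw [← frame_frameCoord he (w t).1, hw.frameCoord_perp_fst, frame_apply, zero_smul,
      add_zero]
  rw [flowHamPerp_apply, hw.hamFlow_eq, frame_apply, ← hfst, proj_add, add_assoc]

end IsTrajectory

theorem quasiMeasurePreserving_fst_flowHamPerp_hamFlow (he : e ≠ 0)
    (hV : Differentiable ℝ fun v => average e V (proj v)) (hp : FlowIsComplete (pHam e V))
    (hz : z ∈ regularSet e V) :
    Measure.QuasiMeasurePreserving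
      (fun q : ℝ × ℝ => (flowHamPerp e q.2 (hamFlow (pHam e V) hp q.1 z)).1) := by
  obtain ⟨w, hw, -⟩ := hp z
  have hdisplacement := quasiMeasurePreserving_of_hasDerivAt (hw.hasDerivAt_frameCoord_fst he)
    (hw.ae_frameCoord_snd_ne_zero he hV hp hz)
  have hscale : Measure.QuasiMeasurePreserving fun s => s / len e :=
    quasiMeasurePreserving_of_hasDerivAt (fun s => (hasDerivAt_id s).div_const (len e))
      (ae_of_all _ fun _ => one_div_ne_zero (len_pos he).ne')
  have hframe := quasiMeasurePreserving_linearMap_of_surjective (frame_surjective he) volume volume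
  have htranslate := (measurePreserving_add_left volume z.1).quasiMeasurePreserving
  simp only [hw.fst_flowHamPerp_hamFlow he hp]
  exact htranslate.comp <| quasiMeasurePreserving_proj.comp <| hframe.comp <|
    MeasureTheory.QuasiMeasurePreserving.prodMap hdisplacement hscale

theorem measurable_fst_flowHamPerp_hamFlow {Ω : Type*} [MeasurableSpace Ω] {g : Ω → CotT2}
    (hg : Measurable g) (hp : FlowIsComplete (pHam e V))
    (hflow : ∀ t, Measurable (hamFlow (pHam e V) hp t)) :
    Measurable (uncurry fun (q : ℝ × ℝ) (x : Ω) =>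
      (flowHamPerp e q.2 (hamFlow (pHam e V) hp q.1 (g x))).1) :=
  ((measurable_uncurry_hamFlow _ (measurable_flowHamPerp e)).comp <| measurable_fst.snd.prodMk <|
    (measurable_uncurry_hamFlow _ hflow).comp <|
      measurable_fst.fst.prodMk (hg.comp measurable_snd)).fst

end FlowP

theorem IsPrimitiveRankOne.generator_ne_zero {e : Fin 2 → ℤ}
    (h : IsPrimitiveRankOne (AddSubgroup.zmultiples e)) : e ≠ 0 := by
  rintro rfl
  have hzero : intVec 0 = 0 := by ext i; simp [intVec]
  have hrank := h.rank_one
  rw [realSpan, AddSubgroup.zmultiples_zero_eq_bot, AddSubgroup.coe_bot, image_singleton, hzero,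
    Submodule.span_zero_singleton, finrank_bot] at hrank
  exact zero_ne_one hrank

end BiInv

theorem theoremA2_general (V : BiInv.T2 → ℝ) (e : Fin 2 → ℤ) (he : e ≠ 0)
    (hV : Differentiable ℝ fun v => BiInv.average e V (BiInv.proj v))
    (hflow : BiInv.FlowIsComplete (BiInv.pHam e V)) (μ : Measure (BiInv.regularSet e V)) [SFinite μ]
    (hperp : BiInv.IsFlowInvariant μ (BiInv.flowHamPerp e))
    (hp : BiInv.IsFlowInvariant μ (BiInv.hamFlow (BiInv.pHam e V) hflow)) :
    μ.map (fun z : BiInv.regularSet e V => (z : BiInv.CotT2).1) ≪ volume := by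
  let f (q : ℝ × ℝ) (z : BiInv.regularSet e V) : BiInv.T2 :=
    (BiInv.flowHamPerp e q.2 (BiInv.hamFlow (BiInv.pHam e V) hflow q.1 z)).1
  have hmeas : Measurable (Function.uncurry f) :=
    BiInv.measurable_fst_flowHamPerp_hamFlow measurable_subtype_coe hflow fun t =>
      (hp t).measurable
  have hmap (q : ℝ × ℝ) : μ.map (f q) = μ.map fun z : BiInv.regularSet e V => (z : BiInv.CotT2).1 :=
    BiInv.map_comp_comp_of_measurePreserving_map measurable_subtype_coe
      ((hperp q.2).comp (hp q.1)) measurable_fst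
  have horbit (z : BiInv.regularSet e V) : Measure.QuasiMeasurePreserving fun q => f q z :=
    BiInv.quasiMeasurePreserving_fst_flowHamPerp_hamFlow he hV hflow z.2
  exact BiInv.absolutelyContinuous_of_ae_quasiMeasurePreserving hmeas
    (ae_of_all volume fun q => (hmap q).symm.absolutelyContinuous) (ae_of_all μ horbit)

theorem theoremA2 (V : BiInv.T2 → ℝ) (hV : BiInv.SmoothOnTorus V)
    (L : AddSubgroup (Fin 2 → ℤ)) (hL : BiInv.IsPrimitiveRankOne L)
    (e : Fin 2 → ℤ) (he : AddSubgroup.zmultiples e = L)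
    (μ : MeasureTheory.Measure (BiInv.regularSet e V)) [MeasureTheory.IsProbabilityMeasure μ]
    (hperp : BiInv.IsFlowInvariant μ (BiInv.flowHamPerp e))
    (hp : BiInv.IsFlowInvariant μ (BiInv.flowP e V hV)) :
    MeasureTheory.IsProbabilityMeasure
        (μ.map (fun z : BiInv.regularSet e V => (z : BiInv.CotT2).1)) ∧
      (μ.map (fun z : BiInv.regularSet e V => (z : BiInv.CotT2).1)).AbsolutelyContinuous
        (MeasureTheory.volume : MeasureTheory.Measure BiInv.T2) :=
  ⟨Measure.isProbabilityMeasure_map (by fun_prop),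
    theoremA2_general V e (he ▸ hL).generator_ne_zero (hV.differentiable_average e)
      (BiInv.flowIsComplete_pHam e V hV) μ hperp hp⟩
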